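/- Let $d\ge 1$ and let $\Omega\subseteq\mathbb{R}^d$ be an open, bounded, connected domain with Lipschitz boundary. Let $\lambda_1^{(n)},\lambda_2^{(n)}>0$ for $n\in\mathbb{N}$, let $f:\Omega\to\mathbb{R}$, and let $(u_n)_{n\in\mathbb{N}}\subseteq \mathrm{BV}(\Omega)$ be a sequence of corresponding TV–IC solutions: for every $n$ there is $v_n\in L^1(\Omega)$ such that $(u_n,v_n)$ minimises $$(u,v)\mapsto |Du|(\Omega)+\lambda_1^{(n)}\|v\|_{L^1(\Omega)}+\frac{\lambda_2^{(n)}}{2}\|f-u-v\|_{L^2(\Omega)}^2$$ over $\mathrm{BV}(\Omega)\times L^1(\Omega)$ (the last term being $+\infty$ if $f-u-v\notin L^2(\Omega)$). Here $w_n\to w$ weakly* in $\mathrm{BV}(\Omega)$ means that $w_n,w\in\mathrm{BV}(\Omega)$, $w_n\to w$ in $L^1(\Omega)$ and $\int_\Omega\varphi\,dDw_n\to\int_\Omega\varphi\,dDw$ for all $\varphi\in C_0(\Omega)$; a median of $f$ is a minimiser of $c\mapsto\int_\Omega|f-c|\,dx$ over $c\in\mathbb{R}$. (Proposition 2.8)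 If $f\in L^1(\Omega)$, $\lambda_1^{(n)}\to 0$ and $\lambda_1^{(n)}/\lambda_2^{(n)}\to 0$, then every subsequence of $(u_n)$ has a further subsequence that converges weakly* in $\mathrm{BV}(\Omega)$ to (the constant function equal to) a median of $f$. (Companion, Proposition 2.9) If $f\in L^2(\Omega)$, $\lambda_2^{(n)}\to 0$ and $\lambda_2^{(n)}/\lambda_1^{(n)}\to 0$, then $(u_n)$ converges weakly* in $\mathrm{BV}(\Omega)$ to (the constant function equal to) the mean $\frac{1}{|\Omega|}\int_\Omega f\,dx$ of $f$. -/

import Mathlib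

open MeasureTheory Filter Topology Set
open scoped ENNReal NNReal ContDiff

/-- `Ω` has a Lipschitz boundary: near each boundary point `p`, after choosing a suitable unit vector
`e` as the "vertical" direction, `Ω` is the set of points lying strictly above the graph of a
Lipschitz function `γ` of the "horizontal" part `x - ⟪e, x⟫ e` of `x`. -/
def HasLipschitzBoundary {d : ℕ} (Ω : Set (EuclideanSpace ℝ (Fin d))) : Prop :=
  ∀ p ∈ frontier Ω, ∃ r : ℝ, 0 < r ∧ ∃ e : EuclideanSpace ℝ (Fin d), ‖e‖ = 1 ∧
    ∃ (K : ℝ≥0) (γ : EuclideanSpace ℝ (Fin d) → ℝ), LipschitzWith K γ ∧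
      ∀ x ∈ Metric.ball p r, x ∈ Ω ↔ γ (x - inner ℝ e x • e) < inner ℝ e x

/-- A bounded Lipschitz domain: an open, bounded, connected (hence nonempty) set with Lipschitz
boundary. -/
structure IsLipschitzDomain {d : ℕ} (Ω : Set (EuclideanSpace ℝ (Fin d))) : Prop where
  isOpen : IsOpen Ω
  isBounded : Bornology.IsBounded Ω
  isConnected : IsConnected Ω
  lipschitzBoundary : HasLipschitzBoundary Ω

/-- `u ∈ L¹(Ω)` and the distributional gradient of `u` on `Ω` is the finite `ℝᵈ`-valued measure `Du`
(regarded as a measure on `ℝᵈ` carried by `Ω`):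
`∫_Ω u ∇φ dx = - ∫_Ω φ dDu` for all `φ ∈ C_c^∞(Ω)`.
For a given `u` there is at most one such measure. -/
structure HasBVDeriv {d : ℕ} (Ω : Set (EuclideanSpace ℝ (Fin d)))
    (u : EuclideanSpace ℝ (Fin d) → ℝ)
    (Du : VectorMeasure (EuclideanSpace ℝ (Fin d)) (EuclideanSpace ℝ (Fin d))) : Prop where
  integrableOn : IntegrableOn u Ω
  finite : IsFiniteMeasure Du.variation
  carried : Du.variation Ωᶜ = 0
  integral_eq : ∀ φ : EuclideanSpace ℝ (Fin d) → ℝ, ContDiff ℝ ∞ φ → HasCompactSupport φ →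
    tsupport φ ⊆ Ω →
      ∫ x in Ω, u x • gradient φ x = - Du.integral φ (ContinuousLinearMap.lsmul ℝ ℝ)

/-- `u ∈ BV(Ω)`. -/
def IsBV {d : ℕ} (Ω : Set (EuclideanSpace ℝ (Fin d))) (u : EuclideanSpace ℝ (Fin d) → ℝ) : Prop :=
  ∃ Du, HasBVDeriv Ω u Du

/-- The total variation `|Du|(Ω)`: the total mass of the variation measure (with respect to the
Euclidean norm) of the gradient measure `Du`. As `Du` is unique, the infimum is over a single
measure if `u ∈ BV(Ω)`; it is `∞` if `u ∉ BV(Ω)`. -/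
noncomputable def totalVar {d : ℕ} (Ω : Set (EuclideanSpace ℝ (Fin d)))
    (u : EuclideanSpace ℝ (Fin d) → ℝ) : ℝ≥0∞ :=
  ⨅ (Du : VectorMeasure (EuclideanSpace ℝ (Fin d)) (EuclideanSpace ℝ (Fin d)))
    (_ : HasBVDeriv Ω u Du), Du.variation Ω

/-- Weak* convergence `uₙ → w` in `BV(Ω)`, for bounded open `Ω`: `uₙ` and `w` are in `BV(Ω)`,
`uₙ → w` in `L¹(Ω)`, and `∫ φ dDuₙ → ∫ φ dDw` for all `φ ∈ C₀(Ω)`. For bounded open `Ω`, the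
extensions by zero of the functions in `C₀(Ω)` are exactly the continuous functions on `ℝᵈ` that
vanish outside `Ω`. -/
def TendstoWeakStarBV {d : ℕ} (Ω : Set (EuclideanSpace ℝ (Fin d)))
    (u : ℕ → EuclideanSpace ℝ (Fin d) → ℝ) (w : EuclideanSpace ℝ (Fin d) → ℝ) : Prop :=
  Tendsto (fun n => ∫ x in Ω, |u n x - w x|) atTop (𝓝 0) ∧
  ∃ (Du : ℕ → VectorMeasure (EuclideanSpace ℝ (Fin d)) (EuclideanSpace ℝ (Fin d)))
    (Dw : VectorMeasure (EuclideanSpace ℝ (Fin d)) (EuclideanSpace ℝ (Fin d))),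
    (∀ n, HasBVDeriv Ω (u n) (Du n)) ∧ HasBVDeriv Ω w Dw ∧
    ∀ φ : EuclideanSpace ℝ (Fin d) → ℝ, Continuous φ → (∀ x ∉ Ω, φ x = 0) →
      Tendsto (fun n => (Du n).integral φ (ContinuousLinearMap.lsmul ℝ ℝ)) atTop
        (𝓝 (Dw.integral φ (ContinuousLinearMap.lsmul ℝ ℝ)))

/-- The energy `|Du|(Ω) + lam₁ ‖v‖_{L¹(Ω)} + (lam₂ / 2) ‖f - u - v‖²_{L²(Ω)}`, with value `∞` if
`f - u - v ∉ L²(Ω)`. -/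
noncomputable def tvicEnergy {d : ℕ} (Ω : Set (EuclideanSpace ℝ (Fin d)))
    (f : EuclideanSpace ℝ (Fin d) → ℝ) (lam₁ lam₂ : ℝ)
    (u v : EuclideanSpace ℝ (Fin d) → ℝ) : ℝ≥0∞ :=
  totalVar Ω u + ENNReal.ofReal lam₁ * eLpNorm v 1 (volume.restrict Ω)
    + ENNReal.ofReal (lam₂ / 2) *
      eLpNorm (fun x => f x - u x - v x) 2 (volume.restrict Ω) ^ 2

/-- `u ∈ BV(Ω)` is a TV–IC solution for the data `f`: it is the first component of a minimising pair
`(u, v)` of the energy over `BV(Ω) × L¹(Ω)`. -/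
def IsTVICSolution {d : ℕ} (Ω : Set (EuclideanSpace ℝ (Fin d)))
    (f : EuclideanSpace ℝ (Fin d) → ℝ) (lam₁ lam₂ : ℝ)
    (u : EuclideanSpace ℝ (Fin d) → ℝ) : Prop :=
  IsBV Ω u ∧ ∃ v : EuclideanSpace ℝ (Fin d) → ℝ, IntegrableOn v Ω ∧
    ∀ u' v' : EuclideanSpace ℝ (Fin d) → ℝ, IsBV Ω u' → IntegrableOn v' Ω →
      tvicEnergy Ω f lam₁ lam₂ u v ≤ tvicEnergy Ω f lam₁ lam₂ u' v'

/-- `m` is a median of `f` on `Ω`: it minimises `c ↦ ∫_Ω |f - c| dx` over `ℝ`. -/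
def IsMedianOn {d : ℕ} (Ω : Set (EuclideanSpace ℝ (Fin d)))
    (f : EuclideanSpace ℝ (Fin d) → ℝ) (m : ℝ) : Prop :=
  ∀ c : ℝ, ∫ x in Ω, |f x - m| ≤ ∫ x in Ω, |f x - c|

/-!
Both limits rest on the Poincaré inequality `∫_Ω |u - ⨍ u| ≤ C |Du|(Ω)` for `u ∈ BV(Ω)`
(`IsLipschitzDomain.exists_integral_abs_sub_average_le`); no compactness theorem in `BV` is needed.

*Poincaré inequality.* If every segment from a point of `A` to a point of `B` lies in `Ω`, then
`∫_A ∫_B |u y - u x| ≤ C |Du|(Ω)` (`HasBVDeriv.lintegral_lintegral_enorm_sub_le`). The function `u`,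
extended by zero, is mollified; the gradient of the mollification at a point well inside `Ω` is
bounded by the mollification of `|Du|`, so the fundamental theorem of calculus along segments and
Fubini give the bound for the mollifications, and Fatou's lemma passes to the limit. Near a boundary
point `Ω` lies above a Lipschitz graph, so all segments from nearby points of `Ω` to a small ball
placed higher up stay in `Ω` (`IsLipschitzDomain.exists_ball_segment_subset`); hence the inequality
holds on `Ω ∩ ball p δ` for some `δ > 0`, for each `p ∈ closure Ω`. Finitely many of these sets cover
`Ω`; the inequality passes to the union of two sets that overlap in positive measure, and since `Ω`
is connected this reaches all of `Ω`.

*Consequence.* If `|Duₙ|(Ω) → 0` and the means of `uₙ` converge to `m`, then `uₙ → m` weakly* in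
`BV(Ω)` (`tendstoWeakStarBV_const`).

*Median.* Comparing `(uₙ, vₙ)` with `(c, f - c)` bounds the energy by `λ₁ ‖f - c‖₁`. Hence
`|Duₙ|(Ω) → 0`, `‖vₙ‖₁ ≤ ‖f - c‖₁` and `‖f - uₙ - vₙ‖₂ → 0`. So the means of `uₙ` are bounded, along
a subsequence `uₙ → m`, and `‖f - m‖₁ ≤ liminf ‖vₙ‖₁ ≤ ‖f - c‖₁`.

*Mean.* Comparing with `(0, 0)` gives `|Duₙ|(Ω) → 0` and `‖vₙ‖₁ → 0`. Comparing with `(uₙ + t, vₙ)`,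
which changes only the last term, shows that `f - uₙ - vₙ` has mean zero, so the means of `uₙ`
converge to the mean of `f`.
-/

/-! ### Functions of bounded variation: gradients of test functions, addition of constants -/

theorem ContDiff.continuous_gradient {E : Type*} [NormedAddCommGroup E] [InnerProductSpace ℝ E]
    [CompleteSpace E] {φ : E → ℝ} (hφ : ContDiff ℝ 1 φ) : Continuous (gradient φ) :=
  (InnerProductSpace.toDual ℝ E).symm.continuous.comp (hφ.continuous_fderiv one_ne_zero)

theorem HasCompactSupport.gradient {E : Type*} [NormedAddCommGroup E] [InnerProductSpace ℝ E]
    [CompleteSpace E] {φ : E → ℝ} (hφ : HasCompactSupport φ) :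
    HasCompactSupport (gradient φ) :=
  (hφ.fderiv ℝ).comp_left (map_zero _)

theorem MeasureTheory.IntegrableOn.smul_gradient {d : ℕ} {Ω : Set (EuclideanSpace ℝ (Fin d))}
    {u φ : EuclideanSpace ℝ (Fin d) → ℝ} (hu : IntegrableOn u Ω) (hφ : ContDiff ℝ 1 φ)
    (hφc : HasCompactSupport φ) : IntegrableOn (fun x => u x • gradient φ x) Ω := by
  obtain ⟨C, hC⟩ := hφ.continuous_gradient.bounded_above_of_compact_support hφc.gradient
  exact hu.smul_bdd C hφ.continuous_gradient.aestronglyMeasurable (ae_of_all _ hC)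

theorem integral_gradient_eq_zero {d : ℕ} {φ : EuclideanSpace ℝ (Fin d) → ℝ}
    (hφ : ContDiff ℝ 1 φ) (hφc : HasCompactSupport φ) : ∫ x, gradient φ x = 0 := by
  have hint : Integrable (gradient φ) :=
    hφ.continuous_gradient.integrable_of_hasCompactSupport hφc.gradient
  refine ext_inner_left ℝ fun v => ?_
  rw [← integral_inner hint, inner_zero_right]
  have hv : ∀ x : EuclideanSpace ℝ (Fin d), inner ℝ v (gradient φ x) = fderiv ℝ φ x v := fun x => by
    rw [real_inner_comm, gradient, InnerProductSpace.toDual_symm_apply]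
  have hintv : Integrable fun x => fderiv ℝ φ x v := by
    simpa only [hv] using hint.const_inner (𝕜 := ℝ) v
  have := integral_mul_fderiv_eq_neg_fderiv_mul_of_integrable (μ := volume)
    (f := fun _ : EuclideanSpace ℝ (Fin d) => (1 : ℝ)) (g := φ) (v := v) (by simp)
    (by simpa using hintv)
    (by simpa using hφ.continuous.integrable_of_hasCompactSupport hφc)
    (fun x _ => differentiableAt_const _) (fun x _ => hφ.differentiable one_ne_zero x)
  simpa [hv] using this

theorem HasBVDeriv.congr_ae {d : ℕ} {Ω : Set (EuclideanSpace ℝ (Fin d))}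
    {u u' : EuclideanSpace ℝ (Fin d) → ℝ}
    {Du : VectorMeasure (EuclideanSpace ℝ (Fin d)) (EuclideanSpace ℝ (Fin d))}
    (h : HasBVDeriv Ω u Du) (huu' : u =ᵐ[volume.restrict Ω] u') : HasBVDeriv Ω u' Du where
  integrableOn := h.integrableOn.congr huu'
  finite := h.finite
  carried := h.carried
  integral_eq φ hφ hφc hφs := by
    rw [← h.integral_eq φ hφ hφc hφs]
    refine integral_congr_ae ?_
    filter_upwards [huu'] with x hx using by rw [hx]

theorem HasBVDeriv.zero {d : ℕ} (Ω : Set (EuclideanSpace ℝ (Fin d))) :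
    HasBVDeriv Ω (fun _ => 0) 0 where
  integrableOn := integrableOn_zero
  finite := by rw [VectorMeasure.variation_zero]; infer_instance
  carried := by simp
  integral_eq φ _ _ _ := by simp

theorem HasBVDeriv.add_const {d : ℕ} {Ω : Set (EuclideanSpace ℝ (Fin d))}
    {u : EuclideanSpace ℝ (Fin d) → ℝ}
    {Du : VectorMeasure (EuclideanSpace ℝ (Fin d)) (EuclideanSpace ℝ (Fin d))}
    (h : HasBVDeriv Ω u Du) (hΩ : volume Ω ≠ ⊤) (c : ℝ) :
    HasBVDeriv Ω (fun x => u x + c) Du where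
  integrableOn := h.integrableOn.add (integrableOn_const hΩ)
  finite := h.finite
  carried := h.carried
  integral_eq φ hφ hφc hφs := by
    have hφ1 : ContDiff ℝ 1 φ := hφ.of_le (by simp)
    have hzero : ∀ x ∉ Ω, gradient φ x = 0 := fun x hx => by
      rw [gradient, image_eq_zero_of_notMem_tsupport
        (fun hx' => hx (hφs (tsupport_fderiv_subset ℝ hx'))), map_zero]
    have hint : IntegrableOn (fun x => u x • gradient φ x) Ω :=
      h.integrableOn.smul_gradient hφ1 hφc
    have hint' : Integrable (gradient φ) :=
      hφ1.continuous_gradient.integrable_of_hasCompactSupport hφc.gradient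
    simp_rw [add_smul]
    rw [integral_add hint (g := fun x => c • gradient φ x) (hint'.integrableOn.smul c),
      integral_smul,
      setIntegral_eq_integral_of_forall_compl_eq_zero hzero,
      integral_gradient_eq_zero hφ1 hφc, smul_zero, add_zero,
      h.integral_eq φ hφ hφc hφs]

theorem HasBVDeriv.const {d : ℕ} {Ω : Set (EuclideanSpace ℝ (Fin d))} (hΩ : volume Ω ≠ ⊤) (c : ℝ) :
    HasBVDeriv Ω (fun _ => c) 0 := by
  simpa using (HasBVDeriv.zero Ω).add_const hΩ c

theorem totalVar_const {d : ℕ} {Ω : Set (EuclideanSpace ℝ (Fin d))} (hΩ : volume Ω ≠ ⊤) (c : ℝ) :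
    totalVar Ω (fun _ => c) = 0 :=
  le_antisymm ((iInf₂_le 0 (HasBVDeriv.const hΩ c)).trans (by simp)) zero_le

theorem totalVar_add_const_le {d : ℕ} {Ω : Set (EuclideanSpace ℝ (Fin d))} (hΩ : volume Ω ≠ ⊤)
    (u : EuclideanSpace ℝ (Fin d) → ℝ) (c : ℝ) :
    totalVar Ω (fun x => u x + c) ≤ totalVar Ω u :=
  le_iInf₂ fun Du h => iInf₂_le Du (h.add_const hΩ c)

/-! ### Mollification and integration along segments -/

open scoped Convolution in
/-- The gradient at `x` of the mollification `η ⋆ u` is `∫ η (x - y) dDu(y)`, provided that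
`y ↦ η (x - y)` is a test function on `Ω`; hence it is bounded by the mollification of `|Du|`. -/
theorem HasBVDeriv.enorm_fderiv_convolution_le {d : ℕ} {Ω : Set (EuclideanSpace ℝ (Fin d))}
    {u : EuclideanSpace ℝ (Fin d) → ℝ}
    {Du : VectorMeasure (EuclideanSpace ℝ (Fin d)) (EuclideanSpace ℝ (Fin d))}
    (hΩ : IsOpen Ω) (h : HasBVDeriv Ω u Du) {η : EuclideanSpace ℝ (Fin d) → ℝ}
    (hη : ContDiff ℝ ∞ η) (hηc : HasCompactSupport η) {x : EuclideanSpace ℝ (Fin d)}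
    (hx : ∀ y, x - y ∈ tsupport η → y ∈ Ω) :
    ‖fderiv ℝ (η ⋆[ContinuousLinearMap.lsmul ℝ ℝ, volume] Ω.indicator u) x‖ₑ
      ≤ ∫⁻ y, ‖η (x - y)‖ₑ ∂Du.variation := by
  have hu : Integrable (Ω.indicator u) := h.integrableOn.integrable_indicator hΩ.measurableSet
  have hswap : (η ⋆[ContinuousLinearMap.lsmul ℝ ℝ, volume] Ω.indicator u)
      = (Ω.indicator u ⋆[ContinuousLinearMap.lsmul ℝ ℝ, volume] η) := by
    ext z
    rw [convolution_lsmul_swap, convolution_lsmul]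
    simp [mul_comm]
  set φ : EuclideanSpace ℝ (Fin d) → ℝ := fun y => η (x - y) with hφ
  have hφd : ContDiff ℝ ∞ φ := hη.comp (contDiff_const.sub contDiff_id)
  have hφc : HasCompactSupport φ :=
    hηc.comp_homeomorph (Homeomorph.subLeft x)
  have hφs : tsupport φ ⊆ Ω := by
    intro y hy
    apply hx
    have : tsupport φ = (Homeomorph.subLeft x) ⁻¹' tsupport η :=
      tsupport_comp_eq_preimage η (Homeomorph.subLeft x)
    rw [this] at hy
    exact hy
  have hgrad : ∀ y, gradient φ y = - gradient η (x - y) := by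
    intro y
    have h1 : HasFDerivAt φ (-(fderiv ℝ η (x - y))) y :=
      (((hη.differentiable (by simp)) (x - y)).hasFDerivAt.comp y
        ((hasFDerivAt_id y).const_sub x)).congr_fderiv (by ext v; simp)
    rw [gradient, gradient, h1.fderiv, map_neg]
  have hint : IntegrableOn (fun y => u y • gradient φ y) Ω :=
    h.integrableOn.smul_gradient (hφd.of_le (by simp)) hφc
  have key : fderiv ℝ (η ⋆[ContinuousLinearMap.lsmul ℝ ℝ, volume] Ω.indicator u) x
      = InnerProductSpace.toDual ℝ _ (Du.integral φ (ContinuousLinearMap.lsmul ℝ ℝ)) := by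
    have hη1 : ContDiff ℝ 1 η := hη.of_le (by simp)
    rw [hswap, (hηc.hasFDerivAt_convolution_right _ hu.locallyIntegrable hη1 x).fderiv]
    ext v
    rw [convolution_precompR_apply _ hu.locallyIntegrable (hηc.fderiv ℝ)
      (hη1.continuous_fderiv one_ne_zero), convolution_lsmul, InnerProductSpace.toDual_apply_apply,
      ← neg_eq_iff_eq_neg.mpr (h.integral_eq φ hφd hφc hφs), inner_neg_left, real_inner_comm,
      ← integral_inner hint, ← integral_neg, ← integral_indicator hΩ.measurableSet]
    congr 1
    ext y
    by_cases hy : y ∈ Ω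
    · simp only [indicator_of_mem hy, hgrad, inner_smul_right, inner_neg_right, smul_eq_mul]
      rw [real_inner_comm, gradient, InnerProductSpace.toDual_symm_apply]
      ring
    · simp [hy]
  rw [key, LinearIsometryEquiv.enorm_map]
  refine VectorMeasure.enorm_integral_le_lintegral_enorm.trans ?_
  refine mul_le_of_le_one_left (by positivity) ?_
  rw [← ofReal_norm]
  exact ENNReal.ofReal_le_one.mpr ContinuousLinearMap.opNorm_lsmul_le

theorem enorm_sub_le_lintegral_segment {E : Type*} [NormedAddCommGroup E] [NormedSpace ℝ E]
    {f : E → ℝ} (hf : ContDiff ℝ 1 f) {g : E → ℝ≥0∞} {x y : E}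
    (h : ∀ z ∈ segment ℝ x y, ‖fderiv ℝ f z‖ₑ ≤ g z) :
    ‖f y - f x‖ₑ ≤ ‖y - x‖ₑ * ∫⁻ t in Icc (0 : ℝ) 1, g ((1 - t) • x + t • y) := by
  have hline : ∀ t : ℝ, HasDerivAt (fun t : ℝ => (1 - t) • x + t • y) (y - x) t := by
    intro t
    have h1 := ((hasDerivAt_id t).const_sub 1).smul_const x
    have h2 := (hasDerivAt_id t).smul_const y
    exact (h1.add h2).congr_deriv (by module)
  have hγ : ContDiff ℝ 1 (fun t : ℝ => f ((1 - t) • x + t • y)) := by fun_prop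
  have hderiv : ∀ t : ℝ, deriv (fun t : ℝ => f ((1 - t) • x + t • y)) t
      = fderiv ℝ f ((1 - t) • x + t • y) (y - x) := fun t =>
    ((hf.differentiable one_ne_zero _).hasFDerivAt.comp_hasDerivAt t (hline t)).deriv
  have := enorm_sub_le_lintegral_deriv_of_contDiffOn_Icc hγ.contDiffOn zero_le_one
  simp only [hderiv, sub_self, sub_zero, zero_smul, one_smul, zero_add, add_zero] at this
  refine this.trans ?_
  rw [← lintegral_const_mul' _ _ enorm_ne_top]
  refine setLIntegral_mono' measurableSet_Icc fun t ht => ?_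
  refine (ContinuousLinearMap.le_opENorm _ _).trans ?_
  rw [mul_comm]
  gcongr
  exact h _ ⟨1 - t, t, by linarith [ht.2], ht.1, by ring, rfl⟩

theorem lintegral_comp_add_smul {E : Type*} [NormedAddCommGroup E] [NormedSpace ℝ E]
    [MeasurableSpace E] [BorelSpace E] [FiniteDimensional ℝ E] (μ : Measure E)
    [μ.IsAddHaarMeasure] {g : E → ℝ≥0∞} (hg : Measurable g) (a : E) {r : ℝ} (hr : r ≠ 0) :
    ∫⁻ y, g (a + r • y) ∂μ
      = ENNReal.ofReal |(r ^ Module.finrank ℝ E)⁻¹| * ∫⁻ y, g y ∂μ := by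
  have : ∫⁻ y, g (a + r • y) ∂μ = ∫⁻ y, g (a + y) ∂(μ.map (r • ·)) := by
    rw [lintegral_map (by fun_prop) (by fun_prop)]
  rw [this, Measure.map_addHaar_smul μ hr, lintegral_smul_measure, lintegral_add_left_eq_self,
    smul_eq_mul]

/-- The integral of `g` over all segments from `A` to `B` is controlled by `∫ g`. For fixed `t`, the
Jacobian of `y ↦ (1 - t) • x + t • y` is at least `2⁻ᵈ` if `t ≥ 1 / 2`, and that of
`x ↦ (1 - t) • x + t • y` is so if `t ≤ 1 / 2`. -/
theorem lintegral_lintegral_lintegral_segment_le {E : Type*} [NormedAddCommGroup E]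
    [NormedSpace ℝ E] [MeasurableSpace E] [BorelSpace E] [FiniteDimensional ℝ E] (μ : Measure E)
    [μ.IsAddHaarMeasure] {g : E → ℝ≥0∞} (hg : Measurable g) (A B : Set E) :
    ∫⁻ x in A, ∫⁻ y in B, ∫⁻ t in Icc (0 : ℝ) 1, g ((1 - t) • x + t • y) ∂volume ∂μ ∂μ
      ≤ 2 ^ Module.finrank ℝ E * (μ A + μ B) * ∫⁻ z, g z ∂μ := by
  have hscale : ∀ (a : E) (r : ℝ), 1 / 2 ≤ r →
      ∫⁻ y, g (a + r • y) ∂μ ≤ 2 ^ Module.finrank ℝ E * ∫⁻ z, g z ∂μ := by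
    intro a r hr
    have hr0 : 0 < r := by linarith
    rw [lintegral_comp_add_smul μ hg a hr0.ne']
    gcongr
    rw [← inv_pow, abs_of_nonneg (by positivity), ENNReal.ofReal_pow (by positivity)]
    gcongr
    rw [← ENNReal.ofReal_ofNat]
    apply ENNReal.ofReal_le_ofReal
    rw [inv_le_comm₀ hr0 (by norm_num)]
    linarith
  set I := 2 ^ Module.finrank ℝ E * ∫⁻ z, g z ∂μ with hI
  have hmeas : Measurable (fun q : (E × E) × ℝ => g ((1 - q.2) • q.1.1 + q.2 • q.1.2)) :=
    hg.comp (by fun_prop)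
  have hslice : ∀ t ∈ Icc (0 : ℝ) 1,
      ∫⁻ x in A, ∫⁻ y in B, g ((1 - t) • x + t • y) ∂μ ∂μ ≤ I * (μ A + μ B) := by
    intro t ht
    rcases le_total (1 / 2) t with h | h
    · calc ∫⁻ x in A, ∫⁻ y in B, g ((1 - t) • x + t • y) ∂μ ∂μ
          ≤ ∫⁻ x in A, I ∂μ := by
            refine lintegral_mono fun x => ?_
            exact (setLIntegral_le_lintegral _ _).trans (hscale _ t h)
        _ = I * μ A := by simp
        _ ≤ I * (μ A + μ B) := by gcongr; exact le_self_add
    · have hm2 : Measurable (fun q : E × E => g ((1 - t) • q.1 + t • q.2)) :=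
        hg.comp (by fun_prop)
      rw [lintegral_lintegral_swap hm2.aemeasurable]
      calc ∫⁻ y in B, ∫⁻ x in A, g ((1 - t) • x + t • y) ∂μ ∂μ
          ≤ ∫⁻ y in B, I ∂μ := by
            refine lintegral_mono fun y => ?_
            refine (setLIntegral_le_lintegral _ _).trans ?_
            simp_rw [add_comm _ (t • y)]
            exact hscale _ (1 - t) (by linarith)
        _ = I * μ B := by simp
        _ ≤ I * (μ A + μ B) := by gcongr; exact le_add_self
  calc ∫⁻ x in A, ∫⁻ y in B, ∫⁻ t in Icc (0 : ℝ) 1, g ((1 - t) • x + t • y) ∂volume ∂μ ∂μ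
      = ∫⁻ x in A, ∫⁻ t in Icc (0 : ℝ) 1,
          ∫⁻ y in B, g ((1 - t) • x + t • y) ∂μ ∂volume ∂μ := by
        refine lintegral_congr fun x => ?_
        rw [lintegral_lintegral_swap]
        exact (hg.comp (by fun_prop :
          Measurable fun q : E × ℝ => (1 - q.2) • x + q.2 • q.1)).aemeasurable
    _ = ∫⁻ t in Icc (0 : ℝ) 1, ∫⁻ x in A, ∫⁻ y in B, g ((1 - t) • x + t • y) ∂μ ∂μ := by
        rw [lintegral_lintegral_swap]
        refine Measurable.aemeasurable ?_
        refine Measurable.lintegral_prod_right' (f := fun p : (E × ℝ) × E =>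
          g ((1 - p.1.2) • p.1.1 + p.1.2 • p.2)) ?_
        exact hg.comp (by fun_prop)
    _ ≤ ∫⁻ t in Icc (0 : ℝ) 1, I * (μ A + μ B) := setLIntegral_mono measurable_const hslice
    _ = 2 ^ Module.finrank ℝ E * (μ A + μ B) * ∫⁻ z, g z ∂μ := by
        simp [hI]; ring

/-- The mean oscillation of `u` between two sets `A` and `B`, all of whose connecting segments lie in
`Ω`, is controlled by the total mass of `Du`. -/
theorem HasBVDeriv.lintegral_lintegral_enorm_sub_le {d : ℕ} {Ω : Set (EuclideanSpace ℝ (Fin d))}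
    {u : EuclideanSpace ℝ (Fin d) → ℝ}
    {Du : VectorMeasure (EuclideanSpace ℝ (Fin d)) (EuclideanSpace ℝ (Fin d))}
    (hΩ : IsOpen Ω) (h : HasBVDeriv Ω u Du)
    {A B : Set (EuclideanSpace ℝ (Fin d))}
    (hA : MeasurableSet A) (hB : MeasurableSet B)
    (hseg : ∀ x ∈ A, ∀ y ∈ B, segment ℝ x y ⊆ Ω) {D : ℝ≥0}
    (hD : ∀ x ∈ A, ∀ y ∈ B, ‖y - x‖ₑ ≤ D) :
    ∫⁻ x in A, ∫⁻ y in B, ‖u y - u x‖ₑ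
      ≤ D * (2 ^ d * (volume A + volume B)) * Du.variation Ω := by
  have := h.finite
  have hvol : Du.variation univ = Du.variation Ω := by
    rw [← measure_add_measure_compl hΩ.measurableSet, h.carried, add_zero]
  have hui : Integrable (Ω.indicator u) := h.integrableOn.integrable_indicator hΩ.measurableSet
  -- a standard mollifier at scale `2 / (n + 1)`
  let φ : ℕ → ContDiffBump (0 : EuclideanSpace ℝ (Fin d)) := fun n =>
    ⟨1 / ((n : ℝ) + 1), 2 * (1 / ((n : ℝ) + 1)), by positivity, by
      have : 0 < 1 / ((n : ℝ) + 1) := by positivity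
      linarith⟩
  have hφ : Tendsto (fun n => (φ n).rOut) atTop (𝓝 0) := by
    have := tendsto_one_div_add_atTop_nhds_zero_nat.const_mul (2 : ℝ)
    rwa [mul_zero] at this
  let w : ℕ → EuclideanSpace ℝ (Fin d) → ℝ := fun n =>
    MeasureTheory.convolution ((φ n).normed volume) (Ω.indicator u)
      (ContinuousLinearMap.lsmul ℝ ℝ) volume
  have hw : ∀ᵐ x, Tendsto (fun n => w n x) atTop (𝓝 (Ω.indicator u x)) :=
    ContDiffBump.ae_convolution_tendsto_right_of_locallyIntegrable hφ (K := 2)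
      (Eventually.of_forall fun n => le_rfl) hui.locallyIntegrable
  have hwd : ∀ n, ContDiff ℝ 1 (w n) := fun n =>
    (φ n).hasCompactSupport_normed.contDiff_convolution_left _ (φ n).contDiff_normed
      hui.locallyIntegrable
  let g : ℕ → EuclideanSpace ℝ (Fin d) → ℝ≥0∞ := fun n x =>
    ∫⁻ y, ‖(φ n).normed volume (x - y)‖ₑ ∂Du.variation
  have hgm : ∀ n, Measurable fun p : EuclideanSpace ℝ (Fin d) × EuclideanSpace ℝ (Fin d) =>
      ‖(φ n).normed volume (p.1 - p.2)‖ₑ := fun n =>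
    ((φ n).continuous_normed.comp (by fun_prop)).enorm.measurable
  have hg : ∀ n, Measurable (g n) := fun n => (hgm n).lintegral_prod_right'
  have hgI : ∀ n, ∫⁻ x, g n x = Du.variation Ω := by
    intro n
    have h1 : ∫⁻ x, ‖(φ n).normed volume x‖ₑ = 1 := by
      rw [← ofReal_integral_norm_eq_lintegral_enorm (φ n).integrable_normed]
      simp_rw [Real.norm_of_nonneg ((φ n).nonneg_normed _)]
      rw [(φ n).integral_normed, ENNReal.ofReal_one]
    calc ∫⁻ x, g n x
        = ∫⁻ y, ∫⁻ x, ‖(φ n).normed volume (x - y)‖ₑ ∂volume ∂Du.variation :=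
          lintegral_lintegral_swap (hgm n).aemeasurable
      _ = ∫⁻ y, 1 ∂Du.variation := by
          refine lintegral_congr fun y => ?_
          rw [lintegral_sub_right_eq_self (fun x => ‖(φ n).normed volume x‖ₑ) y, h1]
      _ = Du.variation Ω := by rw [lintegral_one, hvol]
  let F : ℕ → EuclideanSpace ℝ (Fin d) → EuclideanSpace ℝ (Fin d) → ℝ≥0∞ := fun n x y =>
    D * ∫⁻ t in Icc (0 : ℝ) 1, g n ((1 - t) • x + t • y)
  have hF0 : ∀ n, Measurable fun p : EuclideanSpace ℝ (Fin d) × EuclideanSpace ℝ (Fin d) =>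
      ∫⁻ t in Icc (0 : ℝ) 1, g n ((1 - t) • p.1 + t • p.2) := fun n =>
    Measurable.lintegral_prod_right'
      (f := fun p : (EuclideanSpace ℝ (Fin d) × EuclideanSpace ℝ (Fin d)) × ℝ =>
        g n ((1 - p.2) • p.1.1 + p.2 • p.1.2)) ((hg n).comp (by fun_prop))
  have hF : ∀ n, Measurable (Function.uncurry (F n)) := fun n => (hF0 n).const_mul D
  have hFI : ∀ n, ∫⁻ x in A, ∫⁻ y in B, F n x y
      ≤ D * (2 ^ d * (volume A + volume B)) * Du.variation Ω := by
    intro n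
    have h2 := lintegral_lintegral_lintegral_segment_le volume (hg n) A B
    rw [hgI, finrank_euclideanSpace_fin] at h2
    calc ∫⁻ x in A, ∫⁻ y in B, F n x y
        = D * ∫⁻ x in A, ∫⁻ y in B, ∫⁻ t in Icc (0 : ℝ) 1, g n ((1 - t) • x + t • y) := by
          simp only [F, lintegral_const_mul' _ _ ENNReal.coe_ne_top]
      _ ≤ _ := by
          rw [mul_assoc]
          gcongr
  -- pointwise bound along the mollified sequence
  have hev : ∀ x ∈ A, ∀ y ∈ B, ∀ᶠ n in atTop, ‖w n y - w n x‖ₑ ≤ F n x y := by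
    intro x hx y hy
    have hcomp : IsCompact (segment ℝ x y) := by
      rw [segment_eq_image]
      exact isCompact_Icc.image (by fun_prop)
    obtain ⟨δ, hδ, hδs⟩ := hcomp.exists_cthickening_subset_open hΩ (hseg x hx y hy)
    filter_upwards [hφ.eventually (gt_mem_nhds hδ)] with n hn
    refine (enorm_sub_le_lintegral_segment (hwd n) (g := g n) fun z hz => ?_).trans ?_
    · refine h.enorm_fderiv_convolution_le hΩ (φ n).contDiff_normed
        (φ n).hasCompactSupport_normed fun y hy => ?_
      rw [(φ n).tsupport_normed_eq, mem_closedBall_zero_iff] at hy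
      refine hδs (Metric.closedBall_subset_cthickening hz δ ?_)
      rw [Metric.mem_closedBall, dist_comm, dist_eq_norm]
      exact hy.trans hn.le
    · exact mul_le_mul' (hD x hx y hy) le_rfl
  have hlim : ∀ᵐ x ∂volume.restrict A, ∀ᵐ y ∂volume.restrict B,
      ‖u y - u x‖ₑ ≤ liminf (fun n => F n x y) atTop := by
    filter_upwards [ae_restrict_of_ae hw, ae_restrict_mem hA] with x hwx hx
    filter_upwards [ae_restrict_of_ae hw, ae_restrict_mem hB] with y hwy hy
    rw [indicator_of_mem (hseg x hx y hy (left_mem_segment ℝ x y))] at hwx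
    rw [indicator_of_mem (hseg x hx y hy (right_mem_segment ℝ x y))] at hwy
    rw [← ((hwy.sub hwx).enorm).liminf_eq]
    exact liminf_le_liminf (hev x hx y hy)
  calc ∫⁻ x in A, ∫⁻ y in B, ‖u y - u x‖ₑ
      ≤ ∫⁻ x in A, ∫⁻ y in B, liminf (fun n => F n x y) atTop := by
        refine lintegral_mono_ae ?_
        filter_upwards [hlim] with x hx using lintegral_mono_ae hx
    _ ≤ ∫⁻ x in A, liminf (fun n => ∫⁻ y in B, F n x y) atTop :=
        lintegral_mono fun x => lintegral_liminf_le fun n => (hF n).of_uncurry_left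
    _ ≤ liminf (fun n => ∫⁻ x in A, ∫⁻ y in B, F n x y) atTop :=
        lintegral_liminf_le fun n => (hF n).lintegral_prod_right
    _ ≤ D * (2 ^ d * (volume A + volume B)) * Du.variation Ω :=
        liminf_le_of_frequently_le' (Frequently.of_forall hFI)

/-! ### Local geometry of a Lipschitz domain -/

/-- Near each point `p` of its closure, a Lipschitz domain is star-shaped with respect to a ball. At a
boundary point, the ball is centred at `p + s • e`, where `e` is the vertical direction of the graph
and `s` is so large that segments towards the ball are steeper than the graph. -/
theorem IsLipschitzDomain.exists_ball_segment_subset {d : ℕ}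
    {Ω : Set (EuclideanSpace ℝ (Fin d))} (hΩ : IsLipschitzDomain Ω)
    {p : EuclideanSpace ℝ (Fin d)} (hp : p ∈ closure Ω) :
    ∃ δ > 0, ∃ q, ∀ x ∈ Ω ∩ Metric.ball p δ, ∀ y ∈ Metric.ball q δ, segment ℝ x y ⊆ Ω := by
  by_cases hpΩ : p ∈ Ω
  · obtain ⟨δ, hδ, hδΩ⟩ := Metric.isOpen_iff.1 hΩ.isOpen p hpΩ
    exact ⟨δ, hδ, p, fun x hx y hy => ((convex_ball p δ).segment_subset hx.2 hy).trans hδΩ⟩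
  obtain ⟨r, hr, e, he, K, γ, hγ, hgraph⟩ :=
    hΩ.lipschitzBoundary p ⟨hp, fun hi => hpΩ (interior_subset hi)⟩
  have hee : inner ℝ e e = 1 := by rw [real_inner_self_eq_norm_sq, he, one_pow]
  have hinner : ∀ z, |inner ℝ e z| ≤ ‖z‖ := fun z => by
    simpa [he] using abs_real_inner_le_norm e z
  have hproj : ∀ z : EuclideanSpace ℝ (Fin d), ‖z - inner ℝ e z • e‖ ≤ 2 * ‖z‖ := fun z => by
    refine (norm_sub_le _ _).trans ?_
    rw [norm_smul, he, mul_one, Real.norm_eq_abs]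
    linarith [hinner z]
  set k : ℝ := (K : ℝ)
  have hk : 0 ≤ k := K.2
  obtain ⟨δ, hδ, hδr⟩ : ∃ δ > 0, (4 * k + 4) * δ = r :=
    ⟨r / (4 * k + 4), by positivity, by field_simp⟩
  set s : ℝ := (4 * k + 2) * δ with hs
  have hs0 : 0 ≤ s := by positivity
  refine ⟨δ, hδ, p + s • e, fun x hx y hy => ?_⟩
  obtain ⟨hxΩ, hxp⟩ := hx
  have hxr : x ∈ Metric.ball p r := Metric.ball_subset_ball (by nlinarith) hxp
  have hyr : y ∈ Metric.ball p r := by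
    rw [Metric.mem_ball, dist_eq_norm] at hy ⊢
    calc ‖y - p‖ = ‖(y - (p + s • e)) + s • e‖ := by congr 1; abel
      _ ≤ ‖y - (p + s • e)‖ + ‖s • e‖ := norm_add_le _ _
      _ < r := by
        rw [norm_smul, he, mul_one, Real.norm_of_nonneg hs0]
        nlinarith
  -- the direction `y - x` is `s • e` up to an error `v` of norm at most `2 * δ`
  set v := (y - (p + s • e)) - (x - p) with hv
  have hyx : y - x = v + s • e := by rw [hv]; abel
  have hvn : ‖v‖ ≤ 2 * δ := by
    rw [Metric.mem_ball, dist_eq_norm] at hy hxp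
    exact (norm_sub_le _ _).trans (by linarith)
  intro z hz
  have hzr : z ∈ Metric.ball p r := (convex_ball p r).segment_subset hxr hyr hz
  rw [segment_eq_image'] at hz
  obtain ⟨t, ht, rfl⟩ := hz
  rw [hgraph _ hzr]
  have hgx := (hgraph x hxr).1 hxΩ
  simp only
  have hheight : inner ℝ e (x + t • (y - x)) = inner ℝ e x + t * (inner ℝ e v + s) := by
    rw [hyx, inner_add_right, inner_smul_right, inner_add_right, inner_smul_right, hee, mul_one]
  have hhor : (x + t • (y - x)) - inner ℝ e (x + t • (y - x)) • e
      = (x - inner ℝ e x • e) + t • (v - inner ℝ e v • e) := by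
    rw [hheight, hyx]
    module
  have hlip : γ ((x + t • (y - x)) - inner ℝ e (x + t • (y - x)) • e)
      ≤ γ (x - inner ℝ e x • e) + k * (t * (2 * ‖v‖)) := by
    have h1 := hγ.dist_le_mul ((x + t • (y - x)) - inner ℝ e (x + t • (y - x)) • e)
      (x - inner ℝ e x • e)
    rw [hhor, dist_eq_norm (_ + _), add_sub_cancel_left, norm_smul,
      Real.norm_of_nonneg ht.1, Real.dist_eq] at h1
    rw [hhor]
    have h2 : k * (t * ‖v - inner ℝ e v • e‖) ≤ k * (t * (2 * ‖v‖)) :=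
      mul_le_mul_of_nonneg_left (mul_le_mul_of_nonneg_left (hproj v) ht.1) hk
    linarith [le_abs_self (γ (x - inner ℝ e x • e + t • (v - inner ℝ e v • e))
      - γ (x - inner ℝ e x • e))]
  have h3 : k * (2 * ‖v‖) ≤ inner ℝ e v + s := by
    have := neg_le_of_abs_le (hinner v)
    nlinarith
  refine hlip.trans_lt ?_
  rw [hheight]
  nlinarith [mul_le_mul_of_nonneg_left h3 ht.1]

/-! ### The Poincaré inequality -/

/-- The Poincaré inequality on `A` with the total variation taken over the whole of `Ω`: on `A`,
every `u ∈ BV(Ω)` is within `C |Du|(Ω)` of some constant in the `L¹` distance, with `C` independent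
of `u`. It is stated for measurable representatives, which loses no generality by
`HasBVDeriv.congr_ae`. -/
def PoincareOn {d : ℕ} (Ω A : Set (EuclideanSpace ℝ (Fin d))) : Prop :=
  ∃ C : ℝ≥0, ∀ u Du, Measurable u → HasBVDeriv Ω u Du →
    ∃ c : ℝ, ∫⁻ x in A, ‖u x - c‖ₑ ≤ C * Du.variation Ω

theorem IsLipschitzDomain.exists_poincareOn_inter_ball {d : ℕ}
    {Ω : Set (EuclideanSpace ℝ (Fin d))} (hΩ : IsLipschitzDomain Ω)
    {p : EuclideanSpace ℝ (Fin d)} (hp : p ∈ closure Ω) :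
    ∃ δ > 0, PoincareOn Ω (Ω ∩ Metric.ball p δ) := by
  obtain ⟨δ, hδ, q, hseg⟩ := hΩ.exists_ball_segment_subset hp
  refine ⟨δ, hδ, ?_⟩
  set A := Ω ∩ Metric.ball p δ with hA
  set B := Metric.ball q δ with hB
  obtain ⟨D, hD⟩ := Metric.isBounded_iff_nndist.1 hΩ.isBounded
  have hdist : ∀ y ∈ B, ∀ x ∈ A, ‖x - y‖ₑ ≤ D := by
    intro y hy x hx
    rw [← edist_eq_enorm_sub, edist_nndist, ENNReal.coe_le_coe]
    exact hD (hseg x hx y hy (left_mem_segment ℝ x y)) (hseg x hx y hy (right_mem_segment ℝ x y))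
  have hBpos : volume B ≠ 0 := (Metric.measure_ball_pos _ _ hδ).ne'
  have hBfin : volume B ≠ ⊤ := measure_ball_lt_top.ne
  have hAfin : volume A ≠ ⊤ := ((measure_mono inter_subset_right).trans_lt measure_ball_lt_top).ne
  have hCfin : (volume B)⁻¹ * (D * (2 ^ d * (volume B + volume A))) ≠ ⊤ := by finiteness
  refine ⟨((volume B)⁻¹ * (D * (2 ^ d * (volume B + volume A)))).toNNReal, fun u Du hu h => ?_⟩
  have key := h.lintegral_lintegral_enorm_sub_le hΩ.isOpen (A := B) (B := A)
    measurableSet_ball (hΩ.isOpen.inter Metric.isOpen_ball).measurableSet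
    (fun y hy x hx => by rw [segment_symm]; exact hseg x hx y hy) hdist
  have hm : Measurable fun x => ∫⁻ y in A, ‖u y - u x‖ₑ :=
    Measurable.lintegral_prod_right' (f := fun z : EuclideanSpace ℝ (Fin d) ×
      EuclideanSpace ℝ (Fin d) => ‖u z.2 - u z.1‖ₑ) (by fun_prop)
  -- a point of `B` at which the inner integral is at most its average
  obtain ⟨x, -, hx⟩ := exists_le_setLAverage hBpos hBfin hm.aemeasurable
  refine ⟨u x, hx.trans ?_⟩
  rw [setLAverage_eq, ENNReal.div_eq_inv_mul, ENNReal.coe_toNNReal hCfin, mul_assoc]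
  gcongr

/-- If `A` and `A'` overlap in positive measure, then the constants approximating `u` on `A` and on
`A'` differ by at most a multiple of `|Du|(Ω)`. -/
theorem PoincareOn.union {d : ℕ} {Ω A A' : Set (EuclideanSpace ℝ (Fin d))}
    (h : PoincareOn Ω A) (h' : PoincareOn Ω A') (hA'fin : volume A' ≠ ⊤)
    (hAA' : volume (A ∩ A') ≠ 0) : PoincareOn Ω (A ∪ A') := by
  obtain ⟨C, hC⟩ := h
  obtain ⟨C', hC'⟩ := h'
  have hfin : volume (A ∩ A') ≠ ⊤ := ((measure_mono inter_subset_right).trans_lt hA'fin.lt_top).ne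
  refine ⟨C + C' + (volume A' * (volume (A ∩ A'))⁻¹).toNNReal * (C + C'), fun u Du hu hD => ?_⟩
  obtain ⟨c, hc⟩ := hC u Du hu hD
  obtain ⟨c', hc'⟩ := hC' u Du hu hD
  have hcc : ‖c' - c‖ₑ * volume (A ∩ A') ≤ (C + C') * Du.variation Ω := by
    calc ‖c' - c‖ₑ * volume (A ∩ A') = ∫⁻ x in A ∩ A', ‖c' - c‖ₑ := by simp
      _ ≤ ∫⁻ x in A ∩ A', (‖u x - c‖ₑ + ‖u x - c'‖ₑ) := by
          refine lintegral_mono fun x => ?_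
          rw [show c' - c = (u x - c) - (u x - c') by ring]
          exact enorm_sub_le
      _ = (∫⁻ x in A ∩ A', ‖u x - c‖ₑ) + ∫⁻ x in A ∩ A', ‖u x - c'‖ₑ :=
          lintegral_add_left (by fun_prop) _
      _ ≤ C * Du.variation Ω + C' * Du.variation Ω :=
          add_le_add ((lintegral_mono_set inter_subset_left).trans hc)
            ((lintegral_mono_set inter_subset_right).trans hc')
      _ = (C + C') * Du.variation Ω := by ring
  have hcc' : ‖c' - c‖ₑ ≤ (volume (A ∩ A'))⁻¹ * ((C + C') * Du.variation Ω) := by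
    rw [← ENNReal.div_eq_inv_mul]
    exact (ENNReal.le_div_iff_mul_le (Or.inl hAA') (Or.inl hfin)).2 hcc
  refine ⟨c, ?_⟩
  calc ∫⁻ x in A ∪ A', ‖u x - c‖ₑ
      ≤ (∫⁻ x in A, ‖u x - c‖ₑ) + ∫⁻ x in A', ‖u x - c‖ₑ := lintegral_union_le _ _ _
    _ ≤ (∫⁻ x in A, ‖u x - c‖ₑ) + ∫⁻ x in A', (‖u x - c'‖ₑ + ‖c' - c‖ₑ) := by
        gcongr with x
        rw [show u x - c = (u x - c') + (c' - c) by ring]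
        exact enorm_add_le _ _
    _ = (∫⁻ x in A, ‖u x - c‖ₑ) + ((∫⁻ x in A', ‖u x - c'‖ₑ) + ‖c' - c‖ₑ * volume A') := by
        rw [lintegral_add_left (by fun_prop)]
        simp
    _ ≤ C * Du.variation Ω + (C' * Du.variation Ω
          + (volume (A ∩ A'))⁻¹ * ((C + C') * Du.variation Ω) * volume A') := by
        gcongr
    _ = _ := by
        push_cast
        rw [ENNReal.coe_toNNReal (by finiteness)]
        ring

theorem IsLipschitzDomain.poincareOn {d : ℕ} {Ω : Set (EuclideanSpace ℝ (Fin d))}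
    (hΩ : IsLipschitzDomain Ω) : PoincareOn Ω Ω := by
  have hloc : ∀ p, ∃ δ > 0, p ∈ closure Ω → PoincareOn Ω (Ω ∩ Metric.ball p δ) := by
    intro p
    by_cases hp : p ∈ closure Ω
    · obtain ⟨δ, hδ, h⟩ := hΩ.exists_poincareOn_inter_ball hp
      exact ⟨δ, hδ, fun _ => h⟩
    · exact ⟨1, one_pos, fun h => absurd h hp⟩
  choose δ hδ hloc using hloc
  have hopen : ∀ p, IsOpen (Ω ∩ Metric.ball p (δ p)) := fun p =>
    hΩ.isOpen.inter Metric.isOpen_ball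
  obtain ⟨t, ht, hcover⟩ := hΩ.isBounded.isCompact_closure.elim_nhds_subcover
    (fun p => Metric.ball p (δ p)) fun p _ => Metric.ball_mem_nhds p (hδ p)
  let U : Finset (EuclideanSpace ℝ (Fin d)) → Set (EuclideanSpace ℝ (Fin d)) := fun S =>
    ⋃ p ∈ S, Ω ∩ Metric.ball p (δ p)
  have hUopen : ∀ S, IsOpen (U S) := fun S => isOpen_biUnion fun p _ => hopen p
  have hUΩ : ∀ S, U S ⊆ Ω := fun S => iUnion₂_subset fun p _ => inter_subset_left
  have hmem : ∀ x ∈ Ω, ∃ p ∈ t, x ∈ Ω ∩ Metric.ball p (δ p) := by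
    intro x hx
    obtain ⟨p, hp, hxp⟩ := mem_iUnion₂.1 (hcover (subset_closure hx))
    exact ⟨p, hp, hx, hxp⟩
  -- a maximal subfamily on whose nonempty union the inequality holds
  classical
  obtain ⟨x₀, hx₀⟩ := hΩ.isConnected.nonempty
  obtain ⟨p₀, hp₀, hxp₀⟩ := hmem x₀ hx₀
  obtain ⟨S, hS, hmax⟩ :=
    (t.powerset.filter fun S => (U S).Nonempty ∧ PoincareOn Ω (U S)).exists_maximal ⟨{p₀}, by
      have hU : U {p₀} = Ω ∩ Metric.ball p₀ (δ p₀) := by simp [U]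
      rw [Finset.mem_filter, Finset.mem_powerset, Finset.singleton_subset_iff, hU]
      exact ⟨hp₀, ⟨x₀, hxp₀⟩, hloc p₀ (ht p₀ hp₀)⟩⟩
  rw [Finset.mem_filter, Finset.mem_powerset] at hS
  obtain ⟨hSt, hSne, hSP⟩ := hS
  suffices hSU : Ω ⊆ U S by rwa [(hUΩ S).antisymm hSU] at hSP
  by_contra hcon
  obtain ⟨x, hx, hxS⟩ := not_subset.1 hcon
  obtain ⟨p, hp, hxp⟩ := hmem x hx
  -- connectedness: the remaining sets meet the union of the subfamily
  have hne : (Ω ∩ (U S ∩ U (t \ S))).Nonempty := by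
    refine hΩ.isConnected.isPreconnected _ _ (hUopen _) (hUopen _) ?_
      (by rwa [inter_eq_right.2 (hUΩ S)])
      ⟨x, hx, mem_iUnion₂.2 ⟨p, Finset.mem_sdiff.2 ⟨hp, fun hpS => hxS ?_⟩, hxp⟩⟩
    · intro y hy
      obtain ⟨p, hp, hyp⟩ := hmem y hy
      by_cases hpS : p ∈ S
      · exact Or.inl (mem_iUnion₂.2 ⟨p, hpS, hyp⟩)
      · exact Or.inr (mem_iUnion₂.2 ⟨p, Finset.mem_sdiff.2 ⟨hp, hpS⟩, hyp⟩)
    · exact mem_iUnion₂.2 ⟨p, hpS, hxp⟩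
  obtain ⟨y, -, hyS, hyT⟩ := hne
  obtain ⟨p', hp', hyp'⟩ := mem_iUnion₂.1 hyT
  obtain ⟨hp't, hp'S⟩ := Finset.mem_sdiff.1 hp'
  have hins : U (insert p' S) = U S ∪ (Ω ∩ Metric.ball p' (δ p')) := by
    simp only [U, Finset.set_biUnion_insert, union_comm]
  refine hp'S (hmax (y := insert p' S) ?_ (Finset.subset_insert p' S) (Finset.mem_insert_self _ _))
  simp only [Finset.mem_filter, Finset.mem_powerset, hins]
  refine ⟨Finset.insert_subset hp't hSt, ⟨y, Or.inl hyS⟩, hSP.union (hloc p' (ht p' hp't)) ?_ ?_⟩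
  · exact ((measure_mono inter_subset_right).trans_lt measure_ball_lt_top).ne
  · exact (((hUopen S).inter (hopen p')).measure_pos volume ⟨y, hyS, hyp'⟩).ne'

/-- The **Poincaré inequality** in `BV` of a Lipschitz domain. -/
theorem IsLipschitzDomain.exists_integral_abs_sub_average_le {d : ℕ}
    {Ω : Set (EuclideanSpace ℝ (Fin d))} (hΩ : IsLipschitzDomain Ω) :
    ∃ C : ℝ, ∀ u Du, HasBVDeriv Ω u Du →
      ∫ x in Ω, |u x - ⨍ y in Ω, u y| ≤ C * (Du.variation Ω).toReal := by
  obtain ⟨C, hC⟩ := hΩ.poincareOn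
  refine ⟨2 * C, fun u Du h => ?_⟩
  have := h.finite
  have : IsFiniteMeasure (volume.restrict Ω) :=
    isFiniteMeasure_restrict.2 hΩ.isBounded.measure_lt_top.ne
  have hvol : 0 < volume.real Ω := ENNReal.toReal_pos
    (hΩ.isOpen.measure_pos volume hΩ.isConnected.nonempty).ne' hΩ.isBounded.measure_lt_top.ne
  have hum := h.integrableOn.aestronglyMeasurable
  obtain ⟨c, hc⟩ := hC (hum.mk u) Du hum.stronglyMeasurable_mk.measurable (h.congr_ae hum.ae_eq_mk)
  have huc : Integrable (fun x => u x - c) (volume.restrict Ω) :=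
    h.integrableOn.sub (integrable_const c)
  have hc' : ∫ x in Ω, |u x - c| ≤ C * (Du.variation Ω).toReal := by
    have h1 : ∫⁻ x in Ω, ‖u x - c‖ₑ ≤ C * Du.variation Ω := by
      refine le_of_eq_of_le (lintegral_congr_ae ?_) hc
      filter_upwards [hum.ae_eq_mk] with x hx using by rw [← hx]
    simp_rw [← Real.norm_eq_abs]
    rw [integral_norm_eq_lintegral_enorm huc.aestronglyMeasurable]
    simpa using ENNReal.toReal_mono (by finiteness) h1
  -- replacing `c` by the mean of `u` at most doubles the constant
  have hmean : volume.real Ω * |c - ⨍ y in Ω, u y| ≤ C * (Du.variation Ω).toReal := by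
    refine le_trans ?_ hc'
    have h2 : volume.real Ω * (⨍ y in Ω, u y) = ∫ y in Ω, u y := by
      rw [setAverage_eq, smul_eq_mul, mul_inv_cancel_left₀ hvol.ne']
    calc volume.real Ω * |c - ⨍ y in Ω, u y| = |∫ x in Ω, (u x - c)| := by
          rw [integral_sub h.integrableOn (integrable_const c), ← h2, setIntegral_const,
            smul_eq_mul, ← mul_sub, abs_mul, abs_of_pos hvol, abs_sub_comm]
      _ ≤ ∫ x in Ω, |u x - c| := abs_integral_le_integral_abs
  calc ∫ x in Ω, |u x - ⨍ y in Ω, u y|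
      ≤ ∫ x in Ω, (|u x - c| + |c - ⨍ y in Ω, u y|) := by
        refine integral_mono (h.integrableOn.sub (integrable_const _)).abs
          (huc.abs.add (integrable_const _)) fun x => abs_sub_le _ _ _
    _ = (∫ x in Ω, |u x - c|) + volume.real Ω * |c - ⨍ y in Ω, u y| := by
        rw [integral_add huc.abs (integrable_const _), setIntegral_const, smul_eq_mul]
    _ ≤ 2 * C * (Du.variation Ω).toReal := by linarith

/-! ### Weak* convergence to a constant -/

/-- If the total variations tend to `0`, then convergence of the means implies weak* convergence in
`BV(Ω)` to the constant function. -/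
theorem tendstoWeakStarBV_const {d : ℕ} {Ω : Set (EuclideanSpace ℝ (Fin d))}
    (hΩ : IsLipschitzDomain Ω) {u : ℕ → EuclideanSpace ℝ (Fin d) → ℝ} {m : ℝ}
    (hu : ∀ n, IsBV Ω (u n)) (hTV : Tendsto (fun n => totalVar Ω (u n)) atTop (𝓝 0))
    (hm : Tendsto (fun n => ⨍ x in Ω, u n x) atTop (𝓝 m)) :
    TendstoWeakStarBV Ω u (fun _ => m) := by
  have hfin : volume Ω ≠ ⊤ := hΩ.isBounded.measure_lt_top.ne
  have : IsFiniteMeasure (volume.restrict Ω) := isFiniteMeasure_restrict.2 hfin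
  -- gradient measures whose mass is within `1 / (n + 1)` of the infimum
  have hex : ∀ n : ℕ, ∃ Du, HasBVDeriv Ω (u n) Du ∧
      Du.variation Ω ≤ totalVar Ω (u n) + ENNReal.ofReal (1 / ((n : ℝ) + 1)) := by
    intro n
    obtain ⟨Du₀, h₀⟩ := hu n
    have hlt : totalVar Ω (u n)
        < totalVar Ω (u n) + ENNReal.ofReal (1 / ((n : ℝ) + 1)) := by
      have := h₀.finite
      refine ENNReal.lt_add_right ?_ (by simp; positivity)
      exact ((iInf₂_le Du₀ h₀).trans_lt (measure_lt_top _ _)).ne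
    obtain ⟨Du, hDu⟩ := iInf_lt_iff.1 hlt
    obtain ⟨h, hDu⟩ := iInf_lt_iff.1 hDu
    exact ⟨Du, h, hDu.le⟩
  choose Du hDu hvar using hex
  have hvarE : Tendsto (fun n => (Du n).variation Ω) atTop (𝓝 0) := by
    refine tendsto_of_tendsto_of_tendsto_of_le_of_le tendsto_const_nhds ?_
      (fun n => zero_le) hvar
    have := ENNReal.tendsto_ofReal tendsto_one_div_add_atTop_nhds_zero_nat
    simpa using hTV.add this
  have hvarR : Tendsto (fun n => ((Du n).variation Ω).toReal) atTop (𝓝 0) :=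
    (ENNReal.tendsto_toReal ENNReal.zero_ne_top).comp hvarE
  obtain ⟨C, hC⟩ := hΩ.exists_integral_abs_sub_average_le
  refine ⟨?_, Du, 0, hDu, HasBVDeriv.const hfin m, fun φ hφ hφΩ => ?_⟩
  · have hlim : Tendsto (fun n => C * ((Du n).variation Ω).toReal
        + volume.real Ω * |(⨍ x in Ω, u n x) - m|) atTop (𝓝 0) := by
      have h1 := hvarR.const_mul C
      have h2 := ((hm.sub_const m).abs).const_mul (volume.real Ω)
      simpa using h1.add h2
    refine squeeze_zero (fun n => integral_nonneg fun x => abs_nonneg _) (fun n => ?_) hlim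
    have hint : Integrable (fun x => u n x - ⨍ y in Ω, u n y) (volume.restrict Ω) :=
      (hDu n).integrableOn.sub (integrable_const _)
    calc ∫ x in Ω, |u n x - m|
        ≤ ∫ x in Ω, (|u n x - ⨍ y in Ω, u n y| + |(⨍ y in Ω, u n y) - m|) := by
          refine integral_mono ((hDu n).integrableOn.sub (integrable_const _)).abs
            (hint.abs.add (integrable_const _)) fun x => abs_sub_le _ _ _
      _ = (∫ x in Ω, |u n x - ⨍ y in Ω, u n y|)
            + volume.real Ω * |(⨍ y in Ω, u n y) - m| := by
          rw [integral_add hint.abs (integrable_const _), setIntegral_const, smul_eq_mul]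
      _ ≤ _ := by gcongr; exact hC _ _ (hDu n)
  · rw [VectorMeasure.integral_zero_vectorMeasure]
    have hsupp : HasCompactSupport φ := HasCompactSupport.intro hΩ.isBounded.isCompact_closure
      fun x hx => hφΩ x fun hx' => hx (subset_closure hx')
    obtain ⟨M, hM⟩ := hφ.bounded_above_of_compact_support hsupp
    have hlim := hvarR.const_mul (M * ‖(ContinuousLinearMap.lsmul ℝ ℝ :
      ℝ →L[ℝ] EuclideanSpace ℝ (Fin d) →L[ℝ] EuclideanSpace ℝ (Fin d))‖)
    rw [mul_zero] at hlim
    refine squeeze_zero_norm (fun n => ?_) hlim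
    have := (hDu n).finite
    refine (VectorMeasure.norm_integral_le_of_norm_le_const (ae_of_all _ hM)).trans_eq ?_
    congr 1
    rw [Measure.real, ← measure_add_measure_compl hΩ.isOpen.measurableSet, (hDu n).carried,
      add_zero]

/-! ### `L¹` and `L²` norms on a finite measure space -/

theorem eLpNorm_one_eq_ofReal_integral_abs {α : Type*} [MeasurableSpace α] {μ : Measure α}
    {g : α → ℝ} (hg : Integrable g μ) : eLpNorm g 1 μ = ENNReal.ofReal (∫ x, |g x| ∂μ) := by
  rw [eLpNorm_one_eq_lintegral_enorm, ← ofReal_integral_norm_eq_lintegral_enorm hg]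
  rfl

theorem eLpNorm_two_sq_eq_ofReal_integral_sq {α : Type*} [MeasurableSpace α] {μ : Measure α}
    {g : α → ℝ} (hg : MemLp g 2 μ) :
    eLpNorm g 2 μ ^ 2 = ENNReal.ofReal (∫ x, g x ^ 2 ∂μ) := by
  have h := eLpNorm_nnreal_pow_eq_lintegral (f := g) (μ := μ) (p := 2) two_ne_zero
  simp only [NNReal.coe_ofNat, ENNReal.rpow_ofNat, ENNReal.coe_ofNat] at h
  rw [h, ofReal_integral_eq_lintegral_ofReal hg.integrable_sq (ae_of_all _ fun x => sq_nonneg _)]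
  refine lintegral_congr fun x => ?_
  rw [← ofReal_norm, ← ENNReal.ofReal_pow (norm_nonneg _), Real.norm_eq_abs, sq_abs]

theorem tendsto_eLpNorm_one_of_tendsto_eLpNorm_two_sq {α : Type*} [MeasurableSpace α]
    {μ : Measure α} [IsFiniteMeasure μ] {g : ℕ → α → ℝ} (hg : ∀ n, AEStronglyMeasurable (g n) μ)
    (h : Tendsto (fun n => eLpNorm (g n) 2 μ ^ 2) atTop (𝓝 0)) :
    Tendsto (fun n => eLpNorm (g n) 1 μ) atTop (𝓝 0) := by
  have h2 : Tendsto (fun n => eLpNorm (g n) 2 μ) atTop (𝓝 0) := by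
    have := ((ENNReal.continuous_rpow_const (y := 1 / 2)).tendsto 0).comp h
    rw [ENNReal.zero_rpow_of_pos (by norm_num)] at this
    refine this.congr fun n => ?_
    simp only [Function.comp]
    rw [← ENNReal.rpow_natCast, ← ENNReal.rpow_mul]
    norm_num
  have h3 := ENNReal.Tendsto.mul_const h2 (b := μ univ ^ (1 / (1 : ℝ≥0∞).toReal
    - 1 / (2 : ℝ≥0∞).toReal)) (Or.inr (by
      refine ENNReal.rpow_ne_top_of_nonneg ?_ (measure_ne_top _ _)
      norm_num))
  rw [zero_mul] at h3
  exact tendsto_of_tendsto_of_tendsto_of_le_of_le tendsto_const_nhds h3 (fun n => zero_le)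
    fun n => eLpNorm_le_eLpNorm_mul_rpow_measure_univ one_le_two (hg n)

/-- A function that is closest to the constant `0` among all constants in `L²` has mean zero. -/
theorem integral_eq_zero_of_forall_eLpNorm_two_le {α : Type*} [MeasurableSpace α] {μ : Measure α}
    [IsFiniteMeasure μ] {g : α → ℝ} (hg : MemLp g 2 μ)
    (h : ∀ t : ℝ, eLpNorm g 2 μ ^ 2 ≤ eLpNorm (fun x => g x - t) 2 μ ^ 2) :
    ∫ x, g x ∂μ = 0 := by
  have hgi : Integrable g μ := hg.integrable one_le_two
  have hsq : ∀ t : ℝ, 0 ≤ t ^ 2 * μ.real univ - 2 * t * ∫ x, g x ∂μ := by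
    intro t
    have hgt : MemLp (fun x => g x - t) 2 μ := hg.sub (memLp_const t)
    have h1 := h t
    rw [eLpNorm_two_sq_eq_ofReal_integral_sq hg, eLpNorm_two_sq_eq_ofReal_integral_sq hgt,
      ENNReal.ofReal_le_ofReal_iff (integral_nonneg fun x => sq_nonneg _)] at h1
    have h2 : ∫ x, (g x - t) ^ 2 ∂μ
        = (∫ x, g x ^ 2 ∂μ) - 2 * t * (∫ x, g x ∂μ) + t ^ 2 * μ.real univ := by
      have h3 : ∀ x, (g x - t) ^ 2 = g x ^ 2 - 2 * t * g x + t ^ 2 := fun x => by ring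
      simp_rw [h3]
      rw [integral_add (f := fun x => g x ^ 2 - 2 * t * g x)
        (hg.integrable_sq.sub (hgi.const_mul _)) (integrable_const _),
        integral_sub hg.integrable_sq (hgi.const_mul _), integral_const_mul, integral_const,
        smul_eq_mul, mul_comm (μ.real univ)]
    linarith
  set I := ∫ x, g x ∂μ
  have hV : 0 ≤ μ.real univ := measureReal_nonneg
  -- the choice `t = I / (μ univ + 1)` makes the quadratic at most `-I ^ 2 / (μ univ + 1)`
  have h1 := hsq (I / (μ.real univ + 1))
  have h2 : (I / (μ.real univ + 1)) ^ 2 * μ.real univ - 2 * (I / (μ.real univ + 1)) * I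
      = - (I ^ 2 * (μ.real univ + 2) / (μ.real univ + 1) ^ 2) := by
    field_simp
    ring
  rw [h2, neg_nonneg] at h1
  by_contra hI
  have : 0 < I ^ 2 * (μ.real univ + 2) / (μ.real univ + 1) ^ 2 := by positivity
  linarith

/-! ### TV–IC solutions -/

/-- Comparison of a minimiser with the pairs `(c, f - c)`, which only have the `L¹` term. -/
theorem IsTVICSolution.exists_tvicEnergy_le_ofReal {d : ℕ} {Ω : Set (EuclideanSpace ℝ (Fin d))}
    (hΩ : volume Ω ≠ ⊤) {f u : EuclideanSpace ℝ (Fin d) → ℝ} {lam₁ lam₂ : ℝ} (hlam₁ : 0 < lam₁)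
    (hu : IsTVICSolution Ω f lam₁ lam₂ u) (hf : IntegrableOn f Ω) :
    ∃ v, IntegrableOn v Ω ∧ ∀ c : ℝ,
      tvicEnergy Ω f lam₁ lam₂ u v ≤ ENNReal.ofReal (lam₁ * ∫ x in Ω, |f x - c|) := by
  obtain ⟨-, v, hv, hmin⟩ := hu
  refine ⟨v, hv, fun c => ?_⟩
  have hfc : IntegrableOn (fun x => f x - c) Ω := hf.sub (integrableOn_const hΩ)
  refine (hmin (fun _ => c) (fun x => f x - c) ⟨0, HasBVDeriv.const hΩ c⟩ hfc).trans_eq ?_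
  simp only [tvicEnergy, totalVar_const hΩ, sub_self, eLpNorm_zero', zero_add]
  rw [eLpNorm_one_eq_ofReal_integral_abs hfc, ENNReal.ofReal_mul hlam₁.le]
  simp

theorem exists_subseq_tendstoWeakStarBV_median {d : ℕ} {Ω : Set (EuclideanSpace ℝ (Fin d))}
    (hΩ : IsLipschitzDomain Ω) {f : EuclideanSpace ℝ (Fin d) → ℝ} {lam₁ lam₂ : ℕ → ℝ}
    (hlam₁ : ∀ n, 0 < lam₁ n) (hlam₂ : ∀ n, 0 < lam₂ n) {u : ℕ → EuclideanSpace ℝ (Fin d) → ℝ}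
    (hu : ∀ n, IsTVICSolution Ω f (lam₁ n) (lam₂ n) (u n)) (hf : IntegrableOn f Ω)
    (h₁ : Tendsto lam₁ atTop (𝓝 0)) (h₁₂ : Tendsto (fun n => lam₁ n / lam₂ n) atTop (𝓝 0)) :
    ∃ l : ℕ → ℕ, StrictMono l ∧ ∃ m : ℝ, IsMedianOn Ω f m ∧
      TendstoWeakStarBV Ω (fun n => u (l n)) (fun _ => m) := by
  have hfin : volume Ω ≠ ⊤ := hΩ.isBounded.measure_lt_top.ne
  have : IsFiniteMeasure (volume.restrict Ω) := isFiniteMeasure_restrict.2 hfin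
  choose v hv hE using fun n => (hu n).exists_tvicEnergy_le_ofReal hfin (hlam₁ n) hf
  have hui : ∀ n, IntegrableOn (u n) Ω := fun n => (hu n).1.choose_spec.integrableOn
  set w : ℕ → EuclideanSpace ℝ (Fin d) → ℝ := fun n x => f x - u n x - v n x with hw
  have hwi : ∀ n, IntegrableOn (w n) Ω := fun n => (hf.sub (hui n)).sub (hv n)
  set F := ∫ x in Ω, |f x| with hF
  have hE0 : ∀ n, tvicEnergy Ω f (lam₁ n) (lam₂ n) (u n) (v n)
      ≤ ENNReal.ofReal (lam₁ n * F) := fun n => by simpa using hE n 0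
  have hTV : Tendsto (fun n => totalVar Ω (u n)) atTop (𝓝 0) := by
    have hlim := ENNReal.tendsto_ofReal (h₁.mul_const F)
    rw [zero_mul, ENNReal.ofReal_zero] at hlim
    refine tendsto_of_tendsto_of_tendsto_of_le_of_le tendsto_const_nhds hlim (fun n => zero_le)
      fun n => le_trans ?_ (hE0 n)
    rw [tvicEnergy, add_assoc]
    exact le_self_add
  have hvle : ∀ n c, ∫ x in Ω, |v n x| ≤ ∫ x in Ω, |f x - c| := by
    intro n c
    have h : ENNReal.ofReal (lam₁ n) * eLpNorm (v n) 1 (volume.restrict Ω)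
        ≤ ENNReal.ofReal (lam₁ n * ∫ x in Ω, |f x - c|) := by
      refine le_trans ?_ (hE n c)
      rw [tvicEnergy, add_right_comm]
      exact le_add_self
    rw [eLpNorm_one_eq_ofReal_integral_abs (hv n), ← ENNReal.ofReal_mul (hlam₁ n).le,
      ENNReal.ofReal_le_ofReal_iff (mul_nonneg (hlam₁ n).le
        (integral_nonneg fun x => abs_nonneg _))] at h
    exact le_of_mul_le_mul_left h (hlam₁ n)
  have hw2 : Tendsto (fun n => eLpNorm (w n) 2 (volume.restrict Ω) ^ 2) atTop (𝓝 0) := by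
    have hlim := ENNReal.tendsto_ofReal ((h₁₂.const_mul 2).mul_const F)
    rw [mul_zero, zero_mul, ENNReal.ofReal_zero] at hlim
    refine tendsto_of_tendsto_of_tendsto_of_le_of_le tendsto_const_nhds hlim (fun n => zero_le)
      fun n => ?_
    have hl : 0 < lam₂ n / 2 := half_pos (hlam₂ n)
    have h : eLpNorm (w n) 2 (volume.restrict Ω) ^ 2 * ENNReal.ofReal (lam₂ n / 2)
        ≤ ENNReal.ofReal (lam₁ n * F) := by
      refine le_trans ?_ (hE0 n)
      rw [tvicEnergy, mul_comm]
      exact le_add_self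
    refine ((ENNReal.le_div_iff_mul_le (Or.inl (ENNReal.ofReal_pos.2 hl).ne')
      (Or.inl ENNReal.ofReal_ne_top)).2 h).trans_eq ?_
    rw [← ENNReal.ofReal_div_of_pos hl]
    congr 1
    field_simp
  have hw1 : Tendsto (fun n => ∫ x in Ω, |w n x|) atTop (𝓝 0) := by
    have h := tendsto_eLpNorm_one_of_tendsto_eLpNorm_two_sq
      (fun n => (hwi n).aestronglyMeasurable) hw2
    have h' := (ENNReal.tendsto_toReal ENNReal.zero_ne_top).comp h
    refine h'.congr fun n => ?_
    rw [Function.comp, eLpNorm_one_eq_ofReal_integral_abs (hwi n),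
      ENNReal.toReal_ofReal (integral_nonneg fun x => abs_nonneg _)]
  -- the means are bounded because `u n = f - v n - w n` and `‖v n‖₁ ≤ ‖f‖₁`
  have hbdd : ∃ M, ∀ n, |⨍ x in Ω, u n x| ≤ M := by
    obtain ⟨M, hM⟩ := hw1.bddAbove_range
    refine ⟨(volume.real Ω)⁻¹ * (F + F + M), fun n => ?_⟩
    rw [setAverage_eq, smul_eq_mul, abs_mul, abs_of_nonneg (inv_nonneg.2 measureReal_nonneg)]
    gcongr
    calc |∫ x in Ω, u n x| ≤ ∫ x in Ω, |u n x| := abs_integral_le_integral_abs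
      _ ≤ ∫ x in Ω, (|f x| + |v n x| + |w n x|) := by
        refine integral_mono (hui n).abs ((hf.abs.add (hv n).abs).add (hwi n).abs) fun x => ?_
        have : u n x = f x - v n x - w n x := by simp only [hw]; ring
        simp only [this]
        exact (abs_sub _ _).trans (add_le_add_left (abs_sub _ _) _)
      _ = F + (∫ x in Ω, |v n x|) + ∫ x in Ω, |w n x| := by
        rw [integral_add (f := fun x => |f x| + |v n x|) (hf.abs.add (hv n).abs) (hwi n).abs,
          integral_add hf.abs (hv n).abs]
      _ ≤ F + F + M :=
        add_le_add (add_le_add_right (by simpa using hvle n 0) _) (hM (mem_range_self n))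
  obtain ⟨M, hM⟩ := hbdd
  obtain ⟨m, -, l, hl, hm⟩ := tendsto_subseq_of_bounded (Metric.isBounded_Icc (-M) M)
    fun n => abs_le.1 (hM n)
  have hconv : TendstoWeakStarBV Ω (fun n => u (l n)) (fun _ => m) :=
    tendstoWeakStarBV_const hΩ (fun n => (hu (l n)).1) (hTV.comp hl.tendsto_atTop) hm
  refine ⟨l, hl, m, fun c => ?_, hconv⟩
  -- `f - m = (u - m) + v + w`, where `u - m` and `w` tend to `0` in `L¹` and `‖v‖₁ ≤ ‖f - c‖₁`
  have hlim := ((hconv.1.add_const (∫ x in Ω, |f x - c|)).add (hw1.comp hl.tendsto_atTop))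
  rw [zero_add, add_zero] at hlim
  refine ge_of_tendsto' hlim fun n => ?_
  have hum : IntegrableOn (fun x => u (l n) x - m) Ω := (hui _).sub (integrable_const m)
  calc ∫ x in Ω, |f x - m|
      ≤ ∫ x in Ω, (|u (l n) x - m| + |v (l n) x| + |w (l n) x|) := by
        refine integral_mono (hf.sub (integrable_const m)).abs
          ((hum.abs.add (hv _).abs).add (hwi _).abs) fun x => ?_
        have : f x - m = (u (l n) x - m) + v (l n) x + w (l n) x := by simp only [hw]; ring
        simp only [this]
        exact abs_add_three _ _ _
    _ = (∫ x in Ω, |u (l n) x - m|) + (∫ x in Ω, |v (l n) x|) + ∫ x in Ω, |w (l n) x| := by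
        rw [integral_add (f := fun x => |u (l n) x - m| + |v (l n) x|)
          (hum.abs.add (hv _).abs) (hwi _).abs, integral_add hum.abs (hv _).abs]
    _ ≤ _ := by
        refine add_le_add (add_le_add_right (hvle _ c) _) le_rfl

theorem tendstoWeakStarBV_average {d : ℕ} {Ω : Set (EuclideanSpace ℝ (Fin d))}
    (hΩ : IsLipschitzDomain Ω) {f : EuclideanSpace ℝ (Fin d) → ℝ} {lam₁ lam₂ : ℕ → ℝ}
    (hlam₁ : ∀ n, 0 < lam₁ n) (hlam₂ : ∀ n, 0 < lam₂ n) {u : ℕ → EuclideanSpace ℝ (Fin d) → ℝ}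
    (hu : ∀ n, IsTVICSolution Ω f (lam₁ n) (lam₂ n) (u n)) (hf : MemLp f 2 (volume.restrict Ω))
    (h₂ : Tendsto lam₂ atTop (𝓝 0)) (h₂₁ : Tendsto (fun n => lam₂ n / lam₁ n) atTop (𝓝 0)) :
    TendstoWeakStarBV Ω u (fun _ => ⨍ x in Ω, f x) := by
  have hfin : volume Ω ≠ ⊤ := hΩ.isBounded.measure_lt_top.ne
  have : IsFiniteMeasure (volume.restrict Ω) := isFiniteMeasure_restrict.2 hfin
  have hfi : IntegrableOn f Ω := hf.integrable one_le_two
  choose hBV v hv hmin using hu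
  have hui : ∀ n, IntegrableOn (u n) Ω := fun n => (hBV n).choose_spec.integrableOn
  set w : ℕ → EuclideanSpace ℝ (Fin d) → ℝ := fun n x => f x - u n x - v n x with hw
  have hwi : ∀ n, IntegrableOn (w n) Ω := fun n => (hfi.sub (hui n)).sub (hv n)
  set G := ∫ x in Ω, f x ^ 2 with hG
  have hE : ∀ n, tvicEnergy Ω f (lam₁ n) (lam₂ n) (u n) (v n)
      ≤ ENNReal.ofReal (lam₂ n / 2 * G) := by
    intro n
    refine (hmin n (fun _ => 0) (fun _ => 0) ⟨0, HasBVDeriv.zero Ω⟩ integrableOn_zero).trans_eq ?_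
    simp only [tvicEnergy, totalVar_const hfin, sub_zero, eLpNorm_zero', mul_zero, zero_add]
    rw [eLpNorm_two_sq_eq_ofReal_integral_sq hf, ENNReal.ofReal_mul (half_pos (hlam₂ n)).le]
  have hTVle : ∀ n, totalVar Ω (u n) ≤ ENNReal.ofReal (lam₂ n / 2 * G) := fun n => by
    refine le_trans ?_ (hE n)
    rw [tvicEnergy, add_assoc]
    exact le_self_add
  have hTV : Tendsto (fun n => totalVar Ω (u n)) atTop (𝓝 0) := by
    have hlim := ENNReal.tendsto_ofReal ((h₂.div_const 2).mul_const G)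
    rw [zero_div, zero_mul, ENNReal.ofReal_zero] at hlim
    exact tendsto_of_tendsto_of_tendsto_of_le_of_le tendsto_const_nhds hlim (fun n => zero_le)
      hTVle
  have hv0 : Tendsto (fun n => ∫ x in Ω, v n x) atTop (𝓝 0) := by
    have hlim := (h₂₁.div_const 2).mul_const G
    rw [zero_div, zero_mul] at hlim
    refine squeeze_zero_norm (fun n => norm_integral_le_integral_norm _ |>.trans ?_) hlim
    have h : ENNReal.ofReal (lam₁ n) * eLpNorm (v n) 1 (volume.restrict Ω)
        ≤ ENNReal.ofReal (lam₂ n / 2 * G) := by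
      refine le_trans ?_ (hE n)
      rw [tvicEnergy, add_right_comm]
      exact le_add_self
    rw [eLpNorm_one_eq_ofReal_integral_abs (hv n), ← ENNReal.ofReal_mul (hlam₁ n).le,
      ENNReal.ofReal_le_ofReal_iff (mul_nonneg (half_pos (hlam₂ n)).le
        (integral_nonneg fun x => sq_nonneg _))] at h
    simp_rw [Real.norm_eq_abs]
    have h' : ∫ x in Ω, |v n x| ≤ lam₂ n / 2 * G / lam₁ n := by
      rw [le_div_iff₀ (hlam₁ n), mul_comm]
      exact h
    exact h'.trans_eq (by ring)
  -- comparison with `(u n + t, v n)` shows that `w n` has mean zero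
  have hw0 : ∀ n, ∫ x in Ω, w n x = 0 := by
    intro n
    have hl : ENNReal.ofReal (lam₂ n / 2) ≠ 0 := (ENNReal.ofReal_pos.2 (half_pos (hlam₂ n))).ne'
    have hEtop : tvicEnergy Ω f (lam₁ n) (lam₂ n) (u n) (v n) ≠ ⊤ :=
      ((hE n).trans_lt ENNReal.ofReal_lt_top).ne
    rw [tvicEnergy] at hEtop
    have hrest := (ENNReal.add_ne_top.1 hEtop).1
    have hw2 : MemLp (w n) 2 (volume.restrict Ω) := by
      refine ⟨(hwi n).aestronglyMeasurable, lt_top_iff_ne_top.2 fun htop => ?_⟩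
      refine (ENNReal.add_ne_top.1 hEtop).2 ?_
      change ENNReal.ofReal (lam₂ n / 2) * eLpNorm (w n) 2 (volume.restrict Ω) ^ 2 = ⊤
      rw [htop, ENNReal.top_pow two_ne_zero, ENNReal.mul_top hl]
    refine integral_eq_zero_of_forall_eLpNorm_two_le hw2 fun t => ?_
    obtain ⟨Du, hDu⟩ := hBV n
    have h := hmin n (fun x => u n x + t) (v n) ⟨Du, hDu.add_const hfin t⟩ (hv n)
    have hshift : (fun x => f x - (u n x + t) - v n x) = fun x => w n x - t := by
      ext x; simp only [hw]; ring
    rw [tvicEnergy, tvicEnergy, hshift] at h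
    have h' := h.trans (add_le_add_left (add_le_add_left (totalVar_add_const_le hfin (u n) t) _) _)
    rw [ENNReal.add_le_add_iff_left hrest,
      ENNReal.mul_le_mul_iff_right hl ENNReal.ofReal_ne_top] at h'
    exact h'
  refine tendstoWeakStarBV_const hΩ hBV hTV ?_
  have hmean : ∀ n, ⨍ x in Ω, u n x
      = (⨍ x in Ω, f x) - (volume.real Ω)⁻¹ * ∫ x in Ω, v n x := by
    intro n
    have h := hw0 n
    simp only [hw] at h
    rw [integral_sub (f := fun x => f x - u n x) (hfi.sub (hui n)) (hv n),
      integral_sub hfi (hui n)] at h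
    rw [setAverage_eq, setAverage_eq, smul_eq_mul, smul_eq_mul, ← mul_sub]
    congr 1
    linarith
  simp_rw [hmean]
  simpa using (hv0.const_mul (volume.real Ω)⁻¹).const_sub (⨍ x in Ω, f x)

theorem proposition2p8 {d : ℕ} (hd : 1 ≤ d) (Ω : Set (EuclideanSpace ℝ (Fin d)))
    (hΩ : IsLipschitzDomain Ω) (f : EuclideanSpace ℝ (Fin d) → ℝ)
    (lam₁ lam₂ : ℕ → ℝ) (hlam₁ : ∀ n, 0 < lam₁ n) (hlam₂ : ∀ n, 0 < lam₂ n)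
    (u : ℕ → EuclideanSpace ℝ (Fin d) → ℝ)
    (hu : ∀ n, IsTVICSolution Ω f (lam₁ n) (lam₂ n) (u n)) :
    (IntegrableOn f Ω → Tendsto lam₁ atTop (𝓝 0) →
      Tendsto (fun n => lam₁ n / lam₂ n) atTop (𝓝 0) →
        ∀ k : ℕ → ℕ, StrictMono k → ∃ l : ℕ → ℕ, StrictMono l ∧
          ∃ m : ℝ, IsMedianOn Ω f m ∧
            TendstoWeakStarBV Ω (fun n => u (k (l n))) (fun _ => m)) ∧
    (MemLp f 2 (volume.restrict Ω) → Tendsto lam₂ atTop (𝓝 0) →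
      Tendsto (fun n => lam₂ n / lam₁ n) atTop (𝓝 0) →
        TendstoWeakStarBV Ω u (fun _ => ⨍ x in Ω, f x)) :=
  ⟨fun hf h₁ h₁₂ k hk => exists_subseq_tendstoWeakStarBV_median hΩ (fun n => hlam₁ (k n))
      (fun n => hlam₂ (k n)) (fun n => hu (k n)) hf (h₁.comp hk.tendsto_atTop)
      (h₁₂.comp hk.tendsto_atTop),
    fun hf h₂ h₂₁ => tendstoWeakStarBV_average hΩ hlam₁ hlam₂ hu hf h₂ h₂₁⟩
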